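/- Let $(X,\mathcal B,\mu)$ be a standard Borel probability space, that is, $(X,\mathcal B)$ is a standard Borel space and $\mu$ is a probability measure on $\mathcal B$. Let $L_2(X)$ be the space of complex-valued square-integrable functions modulo a.e. equality, and regard $L_\infty(X)$ as a subspace of $L_2(X)$. Let $U=(U_t)_{t\in\mathbb R}$ be a $C_0$-group on $L_2(X)$, that is, a family of bounded linear operators with $U_0=I$, $U_{s+t}=U_sU_t$ for all $s,t\in\mathbb R$, and $t\mapsto U_tf$ norm continuous for every $f\in L_2(X)$; the operators $U_t$ need not be unitary. Let $A$ be the generator of $U$: its domain $D(A)$ consists of all $f\in L_2(X)$ for which $Af:=\lim_{t\to0}\frac1t(U_tf-f)$ exists in $L_2(X)$. Then the following are equivalent. (i) For every $t\in\mathbb R$ there exists a measurable map $T_t\colon X\to X$ such that $U_tf=f\circ T_t$ a.e. for every square-integrable function $f$ (in particular, $f\circ T_t$ depends, up to a.e. equality, only on the a.e. class of $f$). (ii) The space $L_\infty(X)$ is invariant under $U$, i.e. $U_t(L_\infty(X))\subset L_\infty(X)$ for all $t\in\mathbb R$; the space $D(A)\cap L_\infty(X)$ is an algebra, i.e. $fg\in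 D(A)\cap L_\infty(X)$ for all $f,g\in D(A)\cap L_\infty(X)$; and $A$ is a derivation on $D(A)\cap L_\infty(X)$, i.e. $A(fg)=(Af)\,g+f\,(Ag)$ for all $f,g\in D(A)\cap L_\infty(X)$. -/

import Mathlib

open MeasureTheory Filter Topology
open scoped ENNReal

/-- A one-parameter `C₀`-group of bounded operators on a complex normed space. -/
structure IsC0Group {E : Type*} [NormedAddCommGroup E] [NormedSpace ℂ E]
    (U : ℝ → E →L[ℂ] E) : Prop where
  map_zero : U 0 = ContinuousLinearMap.id ℂ E
  map_add : ∀ s t : ℝ, U (s + t) = (U s).comp (U t)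
  continuous_orbit : ∀ x : E, Continuous fun t : ℝ => U t x

/-- `HasGeneratorValue U x y` says that `(U t x - x) / t → y` in norm as `t → 0`, `t ≠ 0`,
i.e. that `x ∈ D(A)` and `A x = y`, where `A` is the generator of `U`. -/
def HasGeneratorValue {E : Type*} [NormedAddCommGroup E] [NormedSpace ℂ E]
    (U : ℝ → E →L[ℂ] E) (x y : E) : Prop :=
  Tendsto (fun t : ℝ => (t : ℂ)⁻¹ • (U t x - x)) (𝓝[≠] 0) (𝓝 y)

theorem HasGeneratorValue.add {E : Type*} [NormedAddCommGroup E] [NormedSpace ℂ E]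
    {U : ℝ → E →L[ℂ] E} {x y x' y' : E}
    (h : HasGeneratorValue U x y) (h' : HasGeneratorValue U x' y') :
    HasGeneratorValue U (x + x') (y + y') := by
  refine (Tendsto.add h h').congr fun t => ?_
  rw [← smul_add, map_add]
  congr 1
  abel

theorem HasGeneratorValue.const_smul {E : Type*} [NormedAddCommGroup E] [NormedSpace ℂ E]
    {U : ℝ → E →L[ℂ] E} {x y : E} (c : ℂ) (h : HasGeneratorValue U x y) :
    HasGeneratorValue U (c • x) (c • y) := by
  refine (Tendsto.const_smul h c).congr fun t => ?_
  rw [map_smul, ← smul_sub, smul_comm]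

theorem hasGeneratorValue_zero {E : Type*} [NormedAddCommGroup E] [NormedSpace ℂ E]
    (U : ℝ → E →L[ℂ] E) : HasGeneratorValue U 0 0 := by
  simp [HasGeneratorValue]

theorem HasGeneratorValue.unique {E : Type*} [NormedAddCommGroup E] [NormedSpace ℂ E]
    {U : ℝ → E →L[ℂ] E} {x y y' : E}
    (h : HasGeneratorValue U x y) (h' : HasGeneratorValue U x y') : y = y' :=
  tendsto_nhds_unique h h'

/-- The (in general unbounded) generator `A` of `U`: its domain `D(A)` is the set of all `x` for
which `lim_{t → 0} (U t x - x) / t` exists in norm, and `A x` is that limit. -/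
noncomputable def generator {E : Type*} [NormedAddCommGroup E] [NormedSpace ℂ E]
    (U : ℝ → E →L[ℂ] E) : E →ₗ.[ℂ] E where
  domain :=
    { carrier := {x | ∃ y, HasGeneratorValue U x y}
      zero_mem' := ⟨0, hasGeneratorValue_zero U⟩
      add_mem' := fun ⟨_, h⟩ ⟨_, h'⟩ => ⟨_, h.add h'⟩
      smul_mem' := fun c _ ⟨_, h⟩ => ⟨_, h.const_smul c⟩ }
  toFun :=
    { toFun := fun x => Classical.choose x.2
      map_add' := fun x x' =>
        (Classical.choose_spec (x + x').2).unique
          ((Classical.choose_spec x.2).add (Classical.choose_spec x'.2))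
      map_smul' := fun c x =>
        (Classical.choose_spec (c • x).2).unique
          ((Classical.choose_spec x.2).const_smul c) }

/-- The subspace `L_∞ ∩ L_2` of `L_2`; it is all of `L_∞` when the measure is finite. -/
noncomputable def boundedL2 {X : Type*} [MeasurableSpace X] (μ : Measure X) :
    Submodule ℂ (Lp ℂ 2 μ) where
  carrier := {f | MemLp f ∞ μ}
  zero_mem' := (memLp_congr_ae (Lp.coeFn_zero ℂ 2 μ)).2 MemLp.zero
  add_mem' := fun {f g} hf hg => (memLp_congr_ae (Lp.coeFn_add f g)).2 (MemLp.add hf hg)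
  smul_mem' := fun c f hf =>
    (memLp_congr_ae (Lp.coeFn_smul c f)).2 (MemLp.const_smul hf c)

/-- A linear subspace `D` of `L_2` is an algebra: the (a.e. pointwise) product of two elements
of `D` is again (the class of) an element of `D`.  No unit is required. -/
def IsFunctionAlgebra {X : Type*} [MeasurableSpace X] {μ : Measure X}
    (D : Submodule ℂ (Lp ℂ 2 μ)) : Prop :=
  ∀ f ∈ D, ∀ g ∈ D, ∃ h ∈ D, (h : X →ₘ[μ] ℂ) = (f : X →ₘ[μ] ℂ) * (g : X →ₘ[μ] ℂ)

/-- For an algebra `D ⊆ D(A)`: the operator `A` is a derivation on `D`, i.e.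
`A (f g) = (A f) g + f (A g)` for all `f, g ∈ D`, with a.e. pointwise products.
Here `h` is the product `f g`, which is an element of `D` because `D` is an algebra. -/
def IsDerivationOn {X : Type*} [MeasurableSpace X] {μ : Measure X}
    (A : Lp ℂ 2 μ →ₗ.[ℂ] Lp ℂ 2 μ) (D : Submodule ℂ (Lp ℂ 2 μ)) : Prop :=
  ∀ f g h : A.domain, (f : Lp ℂ 2 μ) ∈ D → (g : Lp ℂ 2 μ) ∈ D → (h : Lp ℂ 2 μ) ∈ D →
    ((h : Lp ℂ 2 μ) : X →ₘ[μ] ℂ) = ((f : Lp ℂ 2 μ) : X →ₘ[μ] ℂ) * ((g : Lp ℂ 2 μ) : X →ₘ[μ] ℂ) →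
    (A h : X →ₘ[μ] ℂ) =
      (A f : X →ₘ[μ] ℂ) * ((g : Lp ℂ 2 μ) : X →ₘ[μ] ℂ)
        + ((f : Lp ℂ 2 μ) : X →ₘ[μ] ℂ) * (A g : X →ₘ[μ] ℂ)

/-- The operator `V` on `L_2` is the composition operator `f ↦ f ∘ T`, where `f` runs over all
square-integrable functions (not just over one representative per a.e. class). -/
def IsCompositionBy {X : Type*} [MeasurableSpace X] {μ : Measure X}
    (V : Lp ℂ 2 μ →L[ℂ] Lp ℂ 2 μ) (T : X → X) : Prop :=
  ∀ (f : X → ℂ) (hf : MemLp f 2 μ), (V (hf.toLp f) : X → ℂ) =ᵐ[μ] f ∘ T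

/-! The link between (i) and (ii) is multiplicativity, `U t (f g) = (U t f) (U t g)` on L∞.
Composition operators preserve L∞ and are multiplicative; differentiating at `t = 0` gives the
derivation law. Conversely, for `f, g` in D(A) ∩ L∞ the product `w t = (U t f) (U t g)` solves `w' =
A w`, so `U (-t) (w t)` is constant; averaging orbits extends multiplicativity to L∞
(`map_pmul_of_derivation`).

The analytic obstacle is that multiplication is not continuous on L², so the product rule
(`HasDerivAt.pmul`) needs orbits locally bounded in L∞. Two Baire arguments give this:
`exists_mapsTo_essBall` and `eventually_mem_essBall`.

A multiplicative operator sends idempotents to idempotents, hence indicators to indicators. A Borel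
embedding into Cantor space turns this action on sets into a point map (`exists_map_indL2_eq`). -/

/-! ### L∞-balls in L² and the product of L² classes -/

section EssBall

variable {X : Type*} [MeasurableSpace X] {μ : Measure X}

/-- The classes in `L²` that are a.e. bounded by `M`. -/
def essBall (μ : Measure X) (M : ℝ) : Set (Lp ℂ 2 μ) := {f | ∀ᵐ x ∂μ, ‖f x‖ ≤ M}

theorem mem_boundedL2_iff {f : Lp ℂ 2 μ} : f ∈ boundedL2 μ ↔ ∃ M, 0 ≤ M ∧ f ∈ essBall μ M := by
  constructor
  · intro (hf : MemLp f ∞ μ)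
    refine ⟨(eLpNorm f ∞ μ).toReal, ENNReal.toReal_nonneg, ?_⟩
    rw [eLpNorm_exponent_top]
    filter_upwards [ae_le_eLpNormEssSup (f := f) (μ := μ)] with x hx
    have h : eLpNormEssSup f μ ≠ ∞ := by
      have := hf.2.ne
      rwa [eLpNorm_exponent_top] at this
    have := ENNReal.toReal_mono h hx
    simpa using this
  · rintro ⟨M, -, hM⟩
    exact memLp_top_of_bound (Lp.aestronglyMeasurable f) M hM

theorem essBall_mono {M N : ℝ} (h : M ≤ N) : essBall μ M ⊆ essBall μ N := by
  intro f (hf : ∀ᵐ x ∂μ, ‖f x‖ ≤ M)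
  change ∀ᵐ x ∂μ, ‖f x‖ ≤ N
  filter_upwards [hf] with x hx using hx.trans h

theorem zero_mem_essBall {M : ℝ} (hM : 0 ≤ M) : (0 : Lp ℂ 2 μ) ∈ essBall μ M := by
  filter_upwards [Lp.coeFn_zero ℂ 2 μ] with x hx
  rw [hx]
  simpa using hM

theorem smul_mem_essBall {f : Lp ℂ 2 μ} {M : ℝ} (c : ℂ) (hf : f ∈ essBall μ M) :
    c • f ∈ essBall μ (‖c‖ * M) := by
  filter_upwards [hf, Lp.coeFn_smul c f] with x h1 h3
  rw [h3, Pi.smul_apply, norm_smul]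
  gcongr

theorem sub_mem_essBall {f g : Lp ℂ 2 μ} {M N : ℝ} (hf : f ∈ essBall μ M) (hg : g ∈ essBall μ N) :
    f - g ∈ essBall μ (M + N) := by
  filter_upwards [hf, hg, Lp.coeFn_sub f g] with x h1 h2 h3
  rw [h3]
  exact (norm_sub_le _ _).trans (add_le_add h1 h2)

theorem convex_essBall (M : ℝ) : Convex ℝ (essBall μ M) := by
  intro f hf g hg a b ha hb hab
  filter_upwards [hf, hg, Lp.coeFn_add (a • f) (b • g), Lp.coeFn_smul a f, Lp.coeFn_smul b g]
    with x h1 h2 h3 h4 h5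
  rw [h3, Pi.add_apply, h4, h5]
  calc ‖(a • ⇑f) x + (b • ⇑g) x‖ ≤ ‖a • f x‖ + ‖b • g x‖ := norm_add_le _ _
    _ = a * ‖f x‖ + b * ‖g x‖ := by
      rw [norm_smul, norm_smul, Real.norm_of_nonneg ha, Real.norm_of_nonneg hb]
    _ ≤ a * M + b * M := by gcongr
    _ = M := by rw [← add_mul, hab, one_mul]

theorem exists_subseq_tendsto_ae {f : ℕ → Lp ℂ 2 μ} {g : Lp ℂ 2 μ} (h : Tendsto f atTop (𝓝 g)) :
    ∃ ns : ℕ → ℕ, StrictMono ns ∧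
      ∀ᵐ x ∂μ, Tendsto (fun i => f (ns i) x) atTop (𝓝 (g x)) :=
  (tendstoInMeasure_of_tendsto_Lp h).exists_seq_tendsto_ae

/-- The bound passes to the limit along an a.e. convergent subsequence. This L²-closedness feeds
both Baire arguments. -/
theorem isClosed_essBall (M : ℝ) : IsClosed (essBall μ M) := by
  refine IsSeqClosed.isClosed fun f g hf hg => ?_
  obtain ⟨ns, -, h⟩ := exists_subseq_tendsto_ae hg
  filter_upwards [h, ae_all_iff.2 hf] with x hx hfx
  exact le_of_tendsto hx.norm (Eventually.of_forall fun i => hfx _)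

theorem dense_boundedL2 : Dense (boundedL2 μ : Set (Lp ℂ 2 μ)) := by
  refine (Lp.simpleFunc.dense (E := ℂ) (μ := μ) (p := 2) (by simp)).mono ?_
  intro f hf
  have h := Lp.simpleFunc.toSimpleFunc_eq_toFun (⟨f, hf⟩ : Lp.simpleFunc ℂ 2 μ)
  exact (memLp_congr_ae h).1 (SimpleFunc.memLp_top _ μ)

/-- The a.e. pointwise product of two classes in `L²`, with value `0` if it is not in `L²`. -/
noncomputable def pmul (f g : Lp ℂ 2 μ) : Lp ℂ 2 μ :=
  open Classical in
  if h : (f : X →ₘ[μ] ℂ) * (g : X →ₘ[μ] ℂ) ∈ Lp ℂ 2 μ then ⟨_, h⟩ else 0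

theorem pmul_comm (f g : Lp ℂ 2 μ) : pmul f g = pmul g f := by
  unfold pmul
  rw! [mul_comm (f : X →ₘ[μ] ℂ)]
  rfl

theorem coe_pmul {M : ℝ} (f : Lp ℂ 2 μ) {g : Lp ℂ 2 μ} (hg : g ∈ essBall μ M) :
    (pmul f g : X →ₘ[μ] ℂ) = (f : X →ₘ[μ] ℂ) * (g : X →ₘ[μ] ℂ) := by
  have h : (f : X →ₘ[μ] ℂ) * (g : X →ₘ[μ] ℂ) ∈ Lp ℂ 2 μ := by
    rw [Lp.mem_Lp_iff_memLp]
    refine MemLp.of_le_mul (c := M) (Lp.memLp f) (AEEqFun.aestronglyMeasurable _) ?_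
    filter_upwards [hg, AEEqFun.coeFn_mul (f : X →ₘ[μ] ℂ) (g : X →ₘ[μ] ℂ)] with x h1 h2
    rw [h2, Pi.mul_apply, norm_mul, mul_comm]
    gcongr
  simp [pmul, h]

theorem coeFn_pmul {M : ℝ} (f : Lp ℂ 2 μ) {g : Lp ℂ 2 μ} (hg : g ∈ essBall μ M) :
    ∀ᵐ x ∂μ, pmul f g x = f x * g x := by
  have h := AEEqFun.coeFn_mul (f : X →ₘ[μ] ℂ) (g : X →ₘ[μ] ℂ)
  rw [← coe_pmul f hg] at h
  exact h

theorem norm_pmul_le {M : ℝ} (f : Lp ℂ 2 μ) {g : Lp ℂ 2 μ} (hg : g ∈ essBall μ M) :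
    ‖pmul f g‖ ≤ M * ‖f‖ := by
  refine Lp.norm_le_mul_norm_of_ae_le_mul ?_
  filter_upwards [hg, coeFn_pmul f hg] with x h1 h2
  rw [h2, norm_mul, mul_comm]
  gcongr

theorem pmul_mem_essBall {M N : ℝ} {f g : Lp ℂ 2 μ} (hf : f ∈ essBall μ M) (hg : g ∈ essBall μ N)
    (hM : 0 ≤ M) : pmul f g ∈ essBall μ (M * N) := by
  filter_upwards [hf, hg, coeFn_pmul f hg] with x h1 h2 h3
  rw [h3, norm_mul]
  gcongr

theorem sub_pmul {M : ℝ} (f f' : Lp ℂ 2 μ) {g : Lp ℂ 2 μ} (hg : g ∈ essBall μ M) :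
    pmul (f - f') g = pmul f g - pmul f' g := by
  apply Lp.ext
  filter_upwards [coeFn_pmul f hg, coeFn_pmul f' hg, coeFn_pmul (f - f') hg, Lp.coeFn_sub f f',
    Lp.coeFn_sub (pmul f g) (pmul f' g)] with x h1 h2 h3 h4 h5
  simp only [h3, h4, h5, Pi.sub_apply, h1, h2, sub_mul]

theorem pmul_sub {M N : ℝ} (f : Lp ℂ 2 μ) {g g' : Lp ℂ 2 μ} (hg : g ∈ essBall μ M)
    (hg' : g' ∈ essBall μ N) : pmul f (g - g') = pmul f g - pmul f g' := by
  apply Lp.ext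
  filter_upwards [coeFn_pmul f hg, coeFn_pmul f hg', coeFn_pmul f (sub_mem_essBall hg hg'),
    Lp.coeFn_sub g g', Lp.coeFn_sub (pmul f g) (pmul f g')] with x h1 h2 h3 h4 h5
  simp only [h3, h4, h5, Pi.sub_apply, h1, h2, mul_sub]

theorem smul_pmul {M : ℝ} (c : ℝ) (f : Lp ℂ 2 μ) {g : Lp ℂ 2 μ} (hg : g ∈ essBall μ M) :
    pmul (c • f) g = c • pmul f g := by
  apply Lp.ext
  filter_upwards [coeFn_pmul f hg, coeFn_pmul (c • f) hg, Lp.coeFn_smul c f,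
    Lp.coeFn_smul c (pmul f g)] with x h1 h2 h3 h4
  simp only [h2, h3, h4, Pi.smul_apply, h1, smul_mul_assoc]

/-- As `F` is only in L², it is split as `(F - G) + G` with `G` bounded: the bound on `k i` controls
the first part, L²-convergence the second. -/
theorem tendsto_pmul_zero {ι : Type*} {l : Filter ι} {M : ℝ} (hM : 0 ≤ M) (F : Lp ℂ 2 μ)
    {k : ι → Lp ℂ 2 μ}
    (hk : Tendsto k l (𝓝 0)) (hb : ∀ᶠ i in l, k i ∈ essBall μ M) :
    Tendsto (fun i => pmul F (k i)) l (𝓝 0) := by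
  rw [NormedAddGroup.tendsto_nhds_zero] at hk ⊢
  intro ε hε
  obtain ⟨G, hG, hFG⟩ := dense_boundedL2.exists_dist_lt F (ε := ε / 2 / (M + 1)) (by positivity)
  obtain ⟨N, hN, hGN⟩ := mem_boundedL2_iff.1 hG
  filter_upwards [hb, hk (ε / 2 / (N + 1)) (by positivity)] with i h1 h2
  rw [dist_eq_norm] at hFG
  have e : pmul F (k i) = pmul (F - G) (k i) + pmul (k i) G := by
    rw [sub_pmul F G h1, pmul_comm (k i)]
    abel
  have h3 : ‖pmul (F - G) (k i)‖ ≤ ε / 2 := by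
    refine (norm_pmul_le _ h1).trans ?_
    rw [lt_div_iff₀ (by positivity)] at hFG
    nlinarith [norm_nonneg (F - G)]
  have h4 : ‖pmul (k i) G‖ < ε / 2 := by
    refine (norm_pmul_le _ hGN).trans_lt ?_
    rw [lt_div_iff₀ (by positivity)] at h2
    nlinarith [norm_nonneg (k i)]
  rw [e]
  exact (norm_add_le _ _).trans_lt (by linarith)

theorem tendsto_pmul {ι : Type*} {l : Filter ι} {M : ℝ} (hM : 0 ≤ M) {f : ι → Lp ℂ 2 μ}
    {F : Lp ℂ 2 μ} {g : ι → Lp ℂ 2 μ} {G : Lp ℂ 2 μ} (hf : Tendsto f l (𝓝 F))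
    (hg : Tendsto g l (𝓝 G)) (hb : ∀ᶠ i in l, g i ∈ essBall μ M) :
    Tendsto (fun i => pmul (f i) (g i)) l (𝓝 (pmul F G)) := by
  rcases l.eq_or_neBot with rfl | hl
  · exact tendsto_bot
  have hG : G ∈ essBall μ M := (isClosed_essBall M).mem_of_tendsto hg hb
  have h1 : Tendsto (fun i => pmul (f i - F) (g i)) l (𝓝 0) := by
    refine squeeze_zero_norm' (a := fun i => M * ‖f i - F‖) ?_ ?_
    · filter_upwards [hb] with i hi using norm_pmul_le _ hi
    · simpa using (hf.sub_const F).norm.const_mul M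
  have h2 : Tendsto (fun i => pmul F (g i - G)) l (𝓝 0) := by
    refine tendsto_pmul_zero (M := M + M) (by positivity) F (by simpa using hg.sub_const G) ?_
    filter_upwards [hb] with i hi using sub_mem_essBall hi hG
  have h3 := (h1.add h2).add_const (pmul F G)
  rw [add_zero, zero_add] at h3
  refine h3.congr' ?_
  filter_upwards [hb] with i hi
  rw [sub_pmul _ _ hi, pmul_sub _ hi hG]
  abel

/-- In the split difference quotient each L²-convergent slope meets a bounded factor, `v t` or `u
s`; so `u` needs a bound only at `s`. -/
theorem HasDerivAt.pmul {u v : ℝ → Lp ℂ 2 μ} {u' v' : Lp ℂ 2 μ} {s M : ℝ} (hM : 0 ≤ M)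
    (hu : HasDerivAt u u' s) (hv : HasDerivAt v v' s) (hus : u s ∈ essBall μ M)
    (hvb : ∀ᶠ t in 𝓝 s, v t ∈ essBall μ M) :
    HasDerivAt (fun t => _root_.pmul (u t) (v t))
      (_root_.pmul u' (v s) + _root_.pmul (u s) v') s := by
  have hvs : v s ∈ essBall μ M := hvb.self_of_nhds
  have hvc : Tendsto v (𝓝[≠] s) (𝓝 (v s)) := hv.continuousAt.tendsto.mono_left nhdsWithin_le_nhds
  have hvb' := hvb.filter_mono (nhdsWithin_le_nhds (s := {s}ᶜ))
  rw [hasDerivAt_iff_tendsto_slope] at hu hv ⊢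
  have h1 := tendsto_pmul hM hu hvc hvb'
  have h2 : Tendsto (fun t => _root_.pmul (u s) (slope v s t)) (𝓝[≠] s)
      (𝓝 (_root_.pmul (u s) v')) := by
    simp only [pmul_comm (u s)]
    exact tendsto_pmul hM hv tendsto_const_nhds (Eventually.of_forall fun _ => hus)
  refine (h1.add h2).congr' ?_
  filter_upwards [hvb'] with t ht
  simp only [slope_def_module]
  rw [smul_pmul _ _ ht, pmul_comm (u s), smul_pmul _ _ hus, sub_pmul _ _ ht, sub_pmul _ _ hus,
    ← smul_add, pmul_comm (v t), pmul_comm (v s)]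
  congr 1
  abel

theorem coe_pmul_of_mem (f : Lp ℂ 2 μ) {g : Lp ℂ 2 μ} (hg : g ∈ boundedL2 μ) :
    (pmul f g : X →ₘ[μ] ℂ) = (f : X →ₘ[μ] ℂ) * (g : X →ₘ[μ] ℂ) := by
  obtain ⟨M, -, hM⟩ := mem_boundedL2_iff.1 hg
  exact coe_pmul f hM

theorem coe_pmul_of_mem' {f : Lp ℂ 2 μ} (g : Lp ℂ 2 μ) (hf : f ∈ boundedL2 μ) :
    (pmul f g : X →ₘ[μ] ℂ) = (f : X →ₘ[μ] ℂ) * (g : X →ₘ[μ] ℂ) := by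
  rw [pmul_comm, coe_pmul_of_mem g hf, mul_comm]

theorem pmul_mem_boundedL2 {f g : Lp ℂ 2 μ} (hf : f ∈ boundedL2 μ) (hg : g ∈ boundedL2 μ) :
    pmul f g ∈ boundedL2 μ := by
  obtain ⟨M, hM, hfM⟩ := mem_boundedL2_iff.1 hf
  obtain ⟨N, hN, hgN⟩ := mem_boundedL2_iff.1 hg
  exact mem_boundedL2_iff.2 ⟨M * N, by positivity, pmul_mem_essBall hfM hgN hM⟩

end EssBall

/-! ### C₀-groups and their generators -/

section C0Group

variable {E : Type*} [NormedAddCommGroup E] [NormedSpace ℂ E] {U : ℝ → E →L[ℂ] E}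

theorem hasGeneratorValue_iff_hasDerivAt (hU : IsC0Group U) {x y : E} :
    HasGeneratorValue U x y ↔ HasDerivAt (fun t => U t x) y 0 := by
  rw [hasDerivAt_iff_tendsto_slope, HasGeneratorValue]
  refine tendsto_congr fun t => ?_
  rw [slope_def_module, hU.map_zero, sub_zero, ContinuousLinearMap.id_apply, ← Complex.ofReal_inv,
    Complex.coe_smul]

theorem IsC0Group.apply_add (hU : IsC0Group U) (s t : ℝ) (x : E) :
    U (s + t) x = U s (U t x) := by
  rw [hU.map_add]; rfl

theorem IsC0Group.apply_zero (hU : IsC0Group U) (x : E) : U 0 x = x := by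
  rw [hU.map_zero]; rfl

theorem IsC0Group.apply_apply_neg (hU : IsC0Group U) (s : ℝ) (x : E) : U s (U (-s) x) = x := by
  rw [← hU.apply_add, add_neg_cancel, hU.apply_zero]

theorem HasGeneratorValue.map (hU : IsC0Group U) {x y : E} (h : HasGeneratorValue U x y) (s : ℝ) :
    HasGeneratorValue U (U s x) (U s y) := by
  refine (((U s).continuous.tendsto y).comp h).congr fun t => ?_
  rw [Function.comp_apply, map_smul, map_sub, ← hU.apply_add, ← hU.apply_add, add_comm]

theorem HasGeneratorValue.hasDerivAt (hU : IsC0Group U) {x y : E} (h : HasGeneratorValue U x y)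
    (s : ℝ) : HasDerivAt (fun t => U t x) (U s y) s := by
  have h1 := (hasGeneratorValue_iff_hasDerivAt hU).1 (h.map hU s)
  have h2 : HasDerivAt (fun t : ℝ => U (t - s) (U s x)) (U s y) s := by
    have h1' : HasDerivAt (fun t => U t (U s x)) (U s y) (s - s) := by rwa [sub_self]
    exact h1'.comp_sub_const s s
  refine h2.congr_of_eventuallyEq (Eventually.of_forall fun t => ?_)
  simp only [← hU.apply_add, sub_add_cancel]

theorem mem_generator_domain_iff {x : E} :
    x ∈ (generator U).domain ↔ ∃ y, HasGeneratorValue U x y := Iff.rfl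

theorem generator_hasGeneratorValue (x : (generator U).domain) :
    HasGeneratorValue U x (generator U x) := Classical.choose_spec x.2

variable [CompleteSpace E]

theorem IsC0Group.exists_norm_le (hU : IsC0Group U) :
    ∃ C, 0 ≤ C ∧ ∀ t ∈ Set.Icc (-1 : ℝ) 1, ‖U t‖ ≤ C := by
  obtain ⟨C, hC⟩ := banach_steinhaus (g := fun t : Set.Icc (-1 : ℝ) 1 => U t) fun x => by
    obtain ⟨C, hC⟩ := isCompact_Icc.exists_bound_of_continuousOn
      (hU.continuous_orbit x).continuousOn
    exact ⟨C, fun t => hC t t.2⟩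
  exact ⟨C, (norm_nonneg _).trans (hC ⟨0, by simp⟩), fun t ht => hC ⟨t, ht⟩⟩

/-- Strong continuity becomes joint continuity at time 0 through the uniform bound of
`exists_norm_le`. -/
theorem IsC0Group.tendsto_apply (hU : IsC0Group U) {ι : Type*} {l : Filter ι} {s : ι → ℝ}
    {x : ι → E} {y : E} (hs : Tendsto s l (𝓝 0)) (hx : Tendsto x l (𝓝 y)) :
    Tendsto (fun i => U (s i) (x i)) l (𝓝 y) := by
  obtain ⟨C, hC, hUC⟩ := hU.exists_norm_le
  have h1 : Tendsto (fun i => U (s i) (x i - y)) l (𝓝 0) := by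
    refine squeeze_zero_norm' (a := fun i => C * ‖x i - y‖) ?_ ?_
    · filter_upwards [hs (Icc_mem_nhds (by norm_num : (-1 : ℝ) < 0) (by norm_num : (0 : ℝ) < 1))]
        with i hi using (U (s i)).le_of_opNorm_le (hUC _ hi) _
    · simpa using (hx.sub_const y).norm.const_mul C
  have h2 : Tendsto (fun i => U (s i) y) l (𝓝 y) := by
    have := ((hU.continuous_orbit y).tendsto 0).comp hs
    rwa [hU.apply_zero] at this
  have h3 := h1.add h2
  rw [zero_add] at h3
  refine h3.congr fun i => ?_
  rw [map_sub, sub_add_cancel]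

/-- If `w` solves `w' = A w`, then `t ↦ U (-t) (w t)` has zero derivative. -/
theorem IsC0Group.hasDerivAt_neg_apply (hU : IsC0Group U) {w : ℝ → E} {w' : E} {s : ℝ}
    (hw : HasDerivAt w w' s) (hA : HasGeneratorValue U (w s) w') :
    HasDerivAt (fun t => U (-t) (w t)) 0 s := by
  rw [hasDerivAt_iff_tendsto_slope] at hw ⊢
  have hs : Tendsto (fun t : ℝ => s - t) (𝓝[≠] s) (𝓝 0) := by
    have : Tendsto (fun t : ℝ => s - t) (𝓝 s) (𝓝 (s - s)) := tendsto_const_nhds.sub tendsto_id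
    rw [sub_self] at this
    exact this.mono_left nhdsWithin_le_nhds
  have hs' : Tendsto (fun t : ℝ => s - t) (𝓝[≠] s) (𝓝[≠] 0) := by
    refine tendsto_nhdsWithin_iff.2 ⟨hs, ?_⟩
    filter_upwards [self_mem_nhdsWithin] with t ht
    exact sub_ne_zero.2 (Ne.symm ht)
  -- With `U (-t) = U (-s) U (s - t)`, the slope is `U (-s)` applied to `U (s - t)` of the slope of
  -- `w`, minus the generator quotient of `w s` at time `s - t`. Both tend to `w'`.
  have h1 := hU.tendsto_apply hs hw
  have h2 := h1.sub (hA.comp hs')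
  rw [sub_self] at h2
  have h3 := ((U (-s)).continuous.tendsto 0).comp h2
  rw [_root_.map_zero] at h3
  refine h3.congr fun t => ?_
  have e : ∀ z, U (-t) z = U (-s) (U (s - t) z) := fun z => by
    rw [← hU.apply_add]; congr 2; ring
  have e2 : ((s - t : ℝ) : ℂ)⁻¹ = -(((t - s)⁻¹ : ℝ) : ℂ) := by
    rw [← neg_sub t s, Complex.ofReal_neg, inv_neg, Complex.ofReal_inv]
  simp only [Function.comp_apply, slope_def_module, ← Complex.coe_smul, e2]
  rw [e (w t), map_smul (U (s - t)), map_sub (U (s - t)), ← map_sub (U (-s)),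
    ← map_smul (U (-s))]
  congr 1
  module

theorem IsC0Group.tendsto_average (hU : IsC0Group U) (x : E) :
    Tendsto (fun ε : ℝ => ε⁻¹ • ∫ s in (0 : ℝ)..ε, U s x) (𝓝[≠] 0) (𝓝 x) := by
  have h := (hU.continuous_orbit x).integral_hasStrictDerivAt 0 0
  have h := h.hasDerivAt
  rw [hU.apply_zero, hasDerivAt_iff_tendsto_slope] at h
  refine h.congr fun t => ?_
  simp [slope_def_module]

/-- `U t` shifts the integral to `[t, t + ε]`, whose derivative at `t = 0` is the difference of the
endpoint values. -/
theorem IsC0Group.integral_mem_domain (hU : IsC0Group U) (x : E) (ε : ℝ) :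
    (∫ s in (0 : ℝ)..ε, U s x) ∈ (generator U).domain := by
  refine mem_generator_domain_iff.2 ⟨U ε x - x, (hasGeneratorValue_iff_hasDerivAt hU).2 ?_⟩
  have hc := hU.continuous_orbit x
  have h0 : HasDerivAt (fun t => ∫ s in (0 : ℝ)..t, U s x) x 0 := by
    simpa [hU.apply_zero] using (hc.integral_hasStrictDerivAt 0 0).hasDerivAt
  have h1 : HasDerivAt (fun t => ∫ s in (0 : ℝ)..t, U s x) (U ε x) (0 + ε) := by
    rw [zero_add]
    exact (hc.integral_hasStrictDerivAt 0 ε).hasDerivAt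
  refine ((h1.comp_add_const 0 ε).sub h0).congr_of_eventuallyEq (Eventually.of_forall fun t => ?_)
  simp only [Pi.sub_apply]
  rw [← ContinuousLinearMap.intervalIntegral_comp_comm (U t) (hc.intervalIntegrable _ _)]
  simp only [← hU.apply_add]
  rw [intervalIntegral.integral_comp_add_left (fun s => U s x) t,
    intervalIntegral.integral_interval_sub_left (hc.intervalIntegrable _ _)
      (hc.intervalIntegrable _ _), add_zero]

end C0Group

/-! ### From derivations to multiplicative operators -/

section Multiplicative

variable {X : Type*} [MeasurableSpace X] {μ : Measure X} [IsProbabilityMeasure μ]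

theorem norm_le_of_mem_essBall {f : Lp ℂ 2 μ} {M : ℝ} (hM : 0 ≤ M) (hf : f ∈ essBall μ M) :
    ‖f‖ ≤ M := by
  have h := Lp.norm_le_of_ae_bound hM hf
  simpa [measureUnivNNReal] using h

/-- An operator on `L²` that preserves `L∞` is bounded for the `L∞` norm. -/
theorem exists_mapsTo_essBall (V : Lp ℂ 2 μ →L[ℂ] Lp ℂ 2 μ)
    (hV : ∀ f ∈ boundedL2 μ, V f ∈ boundedL2 μ) :
    ∃ C, 0 ≤ C ∧ ∀ M, 0 ≤ M → ∀ f ∈ essBall μ M, V f ∈ essBall μ (C * M) := by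
  -- Rescaling uses `M + ε`, since `M` may vanish; `ε = 1 / (n + 1)` keeps the exceptional null sets
  -- countable.
  suffices h : ∃ C, 0 ≤ C ∧ ∀ f ∈ essBall μ 1, V f ∈ essBall μ C by
    obtain ⟨C, hC, h⟩ := h
    refine ⟨C, hC, fun M hM f hf => ?_⟩
    have key : ∀ ε : ℝ, 0 < ε → V f ∈ essBall μ (C * (M + ε)) := by
      intro ε hε
      have hpos : 0 < M + ε := by positivity
      have h1 : (((M + ε)⁻¹ : ℝ) : ℂ) • f ∈ essBall μ 1 := by
        refine essBall_mono ?_ (smul_mem_essBall _ hf)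
        rw [Complex.norm_real, Real.norm_of_nonneg (by positivity), inv_mul_le_iff₀ hpos]
        linarith
      have h2 := smul_mem_essBall ((M + ε : ℝ) : ℂ) (h _ h1)
      rw [map_smul, smul_smul, ← Complex.ofReal_mul, mul_inv_cancel₀ hpos.ne', Complex.ofReal_one,
        one_smul, Complex.norm_real, Real.norm_of_nonneg hpos.le, mul_comm] at h2
      exact h2
    have h3 : ∀ n : ℕ, V f ∈ essBall μ (C * (M + 1 / ((n : ℝ) + 1))) := fun n =>
      key _ (by positivity)
    filter_upwards [ae_all_iff.2 h3] with x hx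
    have h4 := ((tendsto_one_div_add_atTop_nhds_zero_nat (𝕜 := ℝ)).const_add M).const_mul C
    rw [add_zero] at h4
    exact ge_of_tendsto' h4 hx
  -- Baire category in the unit ball of L∞ with the L² metric: the closed sets `S n` cover it.
  have : CompleteSpace (essBall μ 1) := (isClosed_essBall 1).completeSpace_coe
  have : Nonempty (essBall μ 1) := ⟨⟨0, zero_mem_essBall zero_le_one⟩⟩
  let S : ℕ → Set (essBall μ 1) := fun n => {f | V f ∈ essBall μ n}
  have hS : ∀ n f, f ∈ interior (S n) → V f ∈ essBall μ n := fun n f hf =>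
    (interior_subset hf : f ∈ S n)
  obtain ⟨n, f₀, hf₀⟩ := nonempty_interior_of_iUnion_of_closed (f := S)
    (fun n => (isClosed_essBall n).preimage (V.continuous.comp continuous_subtype_val)) (by
      refine Set.eq_univ_of_forall fun f => Set.mem_iUnion.2 ?_
      obtain ⟨M, -, hM⟩ := mem_boundedL2_iff.1
        (hV f (mem_boundedL2_iff.2 ⟨1, zero_le_one, f.2⟩))
      obtain ⟨n, hn⟩ := exists_nat_ge M
      exact ⟨n, essBall_mono hn hM⟩)
  obtain ⟨r, hr, hball⟩ := Metric.isOpen_iff.1 isOpen_interior f₀ hf₀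
  -- Two elements of the unit ball are at L²-distance at most 2, so `(1 - ε) f₀ + ε g` is within `r`
  -- of `f₀`. Solving for `V g` gives the constant below.
  obtain ⟨ε, hε, hε1, hεr⟩ : ∃ ε : ℝ, 0 < ε ∧ ε ≤ 1 ∧ ε * 2 < r :=
    ⟨min 1 (r / 4), by positivity, min_le_left _ _, by
      have := min_le_right 1 (r / 4)
      linarith⟩
  refine ⟨‖((ε⁻¹ : ℝ) : ℂ)‖ * (n + ‖((1 - ε : ℝ) : ℂ)‖ * n), by positivity, fun g hg => ?_⟩
  have hmem : (1 - ε) • (f₀ : Lp ℂ 2 μ) + ε • g ∈ essBall μ 1 :=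
    convex_essBall 1 f₀.2 hg (by linarith) hε.le (by ring)
  have h1 : V ((1 - ε) • (f₀ : Lp ℂ 2 μ) + ε • g) ∈ essBall μ n := by
    have : (⟨(1 - ε) • (f₀ : Lp ℂ 2 μ) + ε • g, hmem⟩ : essBall μ 1) ∈ Metric.ball f₀ r := by
      rw [Metric.mem_ball, Subtype.dist_eq, dist_eq_norm]
      have e : (1 - ε) • (f₀ : Lp ℂ 2 μ) + ε • g - f₀ = ε • (g - f₀) := by module
      rw [e, norm_smul, Real.norm_of_nonneg hε.le]
      refine lt_of_le_of_lt ?_ hεr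
      gcongr
      refine (norm_sub_le _ _).trans ?_
      have := norm_le_of_mem_essBall zero_le_one hg
      have := norm_le_of_mem_essBall zero_le_one f₀.2
      linarith
    exact hS n ⟨(1 - ε) • (f₀ : Lp ℂ 2 μ) + ε • g, hmem⟩ (hball this)
  have h0 : V f₀ ∈ essBall μ n := hS n f₀ hf₀
  have h2 := smul_mem_essBall ((ε⁻¹ : ℝ) : ℂ)
    (sub_mem_essBall h1 (smul_mem_essBall ((1 - ε : ℝ) : ℂ) h0))
  convert h2 using 1
  rw [← map_smul, ← map_sub, ← map_smul, Complex.coe_smul, Complex.coe_smul]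
  congr 1
  match_scalars <;> field_simp
  ring

/-- The orbit of an element of `L∞` under a `C₀`-group preserving `L∞` is locally bounded
in `L∞`. -/
theorem eventually_mem_essBall {U : ℝ → Lp ℂ 2 μ →L[ℂ] Lp ℂ 2 μ} (hU : IsC0Group U)
    (hinv : ∀ t : ℝ, ∀ f ∈ boundedL2 μ, U t f ∈ boundedL2 μ) {f : Lp ℂ 2 μ}
    (hf : f ∈ boundedL2 μ) (s : ℝ) :
    ∃ M, 0 ≤ M ∧ ∀ᶠ t in 𝓝 s, U t f ∈ essBall μ M := by
  -- Baire on ℝ bounds the orbit near some time `c`; `U (s - c)` carries the bound to `s`.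
  obtain ⟨n, c, hc⟩ := nonempty_interior_of_iUnion_of_closed
    (f := fun n : ℕ => {t : ℝ | U t f ∈ essBall μ n})
    (fun n => (isClosed_essBall n).preimage (hU.continuous_orbit f)) (by
      refine Set.eq_univ_of_forall fun t => Set.mem_iUnion.2 ?_
      obtain ⟨M, -, hM⟩ := mem_boundedL2_iff.1 (hinv t f hf)
      obtain ⟨n, hn⟩ := exists_nat_ge M
      exact ⟨n, essBall_mono hn hM⟩)
  obtain ⟨C, hC, hUC⟩ := exists_mapsTo_essBall (U (s - c)) (hinv _)
  refine ⟨C * n, by positivity, ?_⟩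
  have ht : Tendsto (fun t : ℝ => t + (c - s)) (𝓝 s) (𝓝 c) := by
    have : Tendsto (fun t : ℝ => t + (c - s)) (𝓝 s) (𝓝 (s + (c - s))) :=
      tendsto_id.add_const _
    rwa [add_sub_cancel] at this
  filter_upwards [ht (mem_interior_iff_mem_nhds.1 hc)] with t ht
  have := hUC n (by positivity) _ ht
  rwa [← hU.apply_add, show s - c + (t + (c - s)) = t by ring] at this

variable {U : ℝ → Lp ℂ 2 μ →L[ℂ] Lp ℂ 2 μ}

/-- The product rule for orbits that are locally bounded in `L∞`. -/
theorem hasDerivAt_pmul_orbit (hU : IsC0Group U)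
    (hinv : ∀ t : ℝ, ∀ f ∈ boundedL2 μ, U t f ∈ boundedL2 μ) {f g f' g' : Lp ℂ 2 μ}
    (hf : f ∈ boundedL2 μ) (hg : g ∈ boundedL2 μ) (hf' : HasGeneratorValue U f f')
    (hg' : HasGeneratorValue U g g') (s : ℝ) :
    HasDerivAt (fun t => pmul (U t f) (U t g))
      (pmul (U s f') (U s g) + pmul (U s f) (U s g')) s := by
  obtain ⟨M, hM, hMf⟩ := eventually_mem_essBall hU hinv hf s
  obtain ⟨N, hN, hNg⟩ := eventually_mem_essBall hU hinv hg s
  exact HasDerivAt.pmul (M := max M N) (le_max_of_le_left hM) (hf'.hasDerivAt hU s)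
    (hg'.hasDerivAt hU s) (essBall_mono (le_max_left _ _) hMf.self_of_nhds)
    (hNg.mono fun t ht => essBall_mono (le_max_right _ _) ht)

/-- A derivation generates multiplicative operators: the case of elements of the domain. -/
theorem map_pmul_of_hasGeneratorValue (hU : IsC0Group U)
    (hinv : ∀ t : ℝ, ∀ f ∈ boundedL2 μ, U t f ∈ boundedL2 μ)
    (hder : ∀ f ∈ boundedL2 μ, ∀ g ∈ boundedL2 μ, ∀ f' g', HasGeneratorValue U f f' →
      HasGeneratorValue U g g' → HasGeneratorValue U (pmul f g) (pmul f' g + pmul f g'))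
    {f g f' g' : Lp ℂ 2 μ}
    (hf : f ∈ boundedL2 μ) (hg : g ∈ boundedL2 μ) (hf' : HasGeneratorValue U f f')
    (hg' : HasGeneratorValue U g g') (t : ℝ) :
    U t (pmul f g) = pmul (U t f) (U t g) := by
  have hd : ∀ s, HasDerivAt (fun t => U (-t) (pmul (U t f) (U t g))) 0 s := fun s =>
    hU.hasDerivAt_neg_apply (hasDerivAt_pmul_orbit hU hinv hf hg hf' hg' s)
      (hder _ (hinv s f hf) _ (hinv s g hg) _ _ (hf'.map hU s) (hg'.map hU s))
  have hconst := is_const_of_deriv_eq_zero (fun s => (hd s).differentiableAt)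
    (fun s => (hd s).deriv) 0 t
  simp only [neg_zero, hU.apply_zero] at hconst
  rw [hconst, hU.apply_apply_neg]

/-- Elements of `L∞` are `L²`-limits of sequences in `D(A)` that are bounded in `L∞`. -/
theorem exists_seq_domain (hU : IsC0Group U)
    (hinv : ∀ t : ℝ, ∀ f ∈ boundedL2 μ, U t f ∈ boundedL2 μ) {f : Lp ℂ 2 μ}
    (hf : f ∈ boundedL2 μ) :
    ∃ M, 0 ≤ M ∧ ∃ u : ℝ → Lp ℂ 2 μ, Tendsto u (𝓝[>] 0) (𝓝 f) ∧
      ∀ᶠ ε in 𝓝[>] 0, u ε ∈ essBall μ M ∧ ∃ f', HasGeneratorValue U (u ε) f' := by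
  obtain ⟨M, hM, hMf⟩ := eventually_mem_essBall hU hinv hf 0
  refine ⟨M, hM, fun ε : ℝ => ε⁻¹ • ∫ s in (0 : ℝ)..ε, U s f,
    (hU.tendsto_average f).mono_left (nhdsWithin_mono _ fun x hx => ne_of_gt hx), ?_⟩
  obtain ⟨δ, hδ, hball⟩ := Metric.eventually_nhds_iff.1 hMf
  filter_upwards [Ioo_mem_nhdsGT hδ] with ε hε
  constructor
  -- For small `ε` the average is over points of a closed convex L∞-ball, so it stays there.
  · have e := interval_average_eq (fun s => U s f) 0 ε
    rw [sub_zero] at e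
    rw [← e, Set.uIoc_of_le hε.1.le]
    refine (convex_essBall M).set_average_mem (isClosed_essBall M) ?_ ?_ ?_ ?_
    · simp [hε.1]
    · simp
    · refine (ae_restrict_mem measurableSet_Ioc).mono fun s hs => hball ?_
      rw [Real.dist_eq, sub_zero, abs_of_pos hs.1]
      exact hs.2.trans_lt hε.2
    · exact (hU.continuous_orbit f).integrableOn_Ioc
  · have h := (generator U).domain.smul_mem ((ε⁻¹ : ℝ) : ℂ) (hU.integral_mem_domain f ε)
    rw [Complex.coe_smul] at h
    exact h

/-- Both sides pass to the L²-limit along approximants in D(A), because these and their images under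
`U t` are bounded in L∞. -/
theorem map_pmul_of_derivation (hU : IsC0Group U)
    (hinv : ∀ t : ℝ, ∀ f ∈ boundedL2 μ, U t f ∈ boundedL2 μ)
    (hder : ∀ f ∈ boundedL2 μ, ∀ g ∈ boundedL2 μ, ∀ f' g', HasGeneratorValue U f f' →
      HasGeneratorValue U g g' → HasGeneratorValue U (pmul f g) (pmul f' g + pmul f g'))
    {f g : Lp ℂ 2 μ} (hf : f ∈ boundedL2 μ) (hg : g ∈ boundedL2 μ) (t : ℝ) :
    U t (pmul f g) = pmul (U t f) (U t g) := by
  obtain ⟨M, hM, u, hu, huM⟩ := exists_seq_domain hU hinv hf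
  obtain ⟨N, hN, v, hv, hvN⟩ := exists_seq_domain hU hinv hg
  obtain ⟨C, hC, hUC⟩ := exists_mapsTo_essBall (U t) (hinv t)
  have h1 := ((U t).continuous.tendsto _).comp
    (tendsto_pmul hN hu hv (hvN.mono fun ε hε => hε.1))
  have h2 := tendsto_pmul (mul_nonneg hC hN) (((U t).continuous.tendsto _).comp hu)
    (((U t).continuous.tendsto _).comp hv) (hvN.mono fun ε hε => hUC N hN _ hε.1)
  refine tendsto_nhds_unique h1 (h2.congr' ?_)
  filter_upwards [huM, hvN] with ε ⟨h3, f', hf'⟩ ⟨h4, g', hg'⟩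
  exact (map_pmul_of_hasGeneratorValue hU hinv hder (mem_boundedL2_iff.2 ⟨M, hM, h3⟩)
    (mem_boundedL2_iff.2 ⟨N, hN, h4⟩) hf' hg' t).symm

end Multiplicative

/-! ### Point realization of multiplicative operators -/

section PointRealization

variable {X : Type*} [MeasurableSpace X] {μ : Measure X}

theorem isCompositionBy_of_ae {V : Lp ℂ 2 μ →L[ℂ] Lp ℂ 2 μ} {T : X → X}
    (hT : Measure.QuasiMeasurePreserving T μ μ) (h : ∀ f : Lp ℂ 2 μ, V f =ᵐ[μ] f ∘ T) :
    IsCompositionBy V T := fun _ hf => (h _).trans (hT.ae_eq_comp hf.coeFn_toLp)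

theorem IsCompositionBy.coeFn {V : Lp ℂ 2 μ →L[ℂ] Lp ℂ 2 μ} {T : X → X}
    (h : IsCompositionBy V T) (f : Lp ℂ 2 μ) : ∀ᵐ x ∂μ, V f x = f (T x) := by
  have h1 := h f (Lp.memLp f)
  rw [Lp.toLp_coeFn] at h1
  exact h1

/-- The class in `L²` of the indicator function of a measurable set. -/
noncomputable def indL2 (μ : Measure X) [IsProbabilityMeasure μ] {B : Set X}
    (hB : MeasurableSet B) : Lp ℂ 2 μ :=
  indicatorConstLp 2 hB (measure_ne_top μ B) 1

variable [IsProbabilityMeasure μ]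

theorem coeFn_indL2 {B : Set X} (hB : MeasurableSet B) :
    ∀ᵐ x ∂μ, indL2 μ hB x = B.indicator (fun _ => 1) x :=
  indicatorConstLp_coeFn

theorem indL2_mem_essBall {B : Set X} (hB : MeasurableSet B) : indL2 μ hB ∈ essBall μ 1 := by
  filter_upwards [coeFn_indL2 hB] with x hx
  rw [hx]
  by_cases h : x ∈ B <;> simp [h]

theorem indL2_mem_boundedL2 {B : Set X} (hB : MeasurableSet B) : indL2 μ hB ∈ boundedL2 μ :=
  mem_boundedL2_iff.2 ⟨1, zero_le_one, indL2_mem_essBall hB⟩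

theorem pmul_indL2_univ (f : Lp ℂ 2 μ) : pmul f (indL2 μ MeasurableSet.univ) = f := by
  apply Lp.ext
  filter_upwards [coeFn_indL2 (μ := μ) MeasurableSet.univ,
    coeFn_pmul f (indL2_mem_essBall MeasurableSet.univ)] with x h1 h2
  simp [h1, h2]

theorem indL2_empty : indL2 μ MeasurableSet.empty = 0 := indicatorConstLp_empty

theorem indL2_compl {B : Set X} (hB : MeasurableSet B) :
    indL2 μ hB.compl = indL2 μ MeasurableSet.univ - indL2 μ hB := by
  apply Lp.ext
  filter_upwards [coeFn_indL2 (μ := μ) MeasurableSet.univ, coeFn_indL2 (μ := μ) hB,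
    coeFn_indL2 (μ := μ) hB.compl,
    Lp.coeFn_sub (indL2 μ MeasurableSet.univ) (indL2 μ hB)] with x h1 h2 h3 h4
  rw [h4, Pi.sub_apply, h1, h2, h3]
  by_cases h : x ∈ B <;> simp [h]

theorem indL2_union {B C : Set X} (hB : MeasurableSet B) (hC : MeasurableSet C) :
    indL2 μ (hB.union hC) = indL2 μ hB + indL2 μ hC - pmul (indL2 μ hB) (indL2 μ hC) := by
  apply Lp.ext
  filter_upwards [coeFn_indL2 (μ := μ) hB, coeFn_indL2 (μ := μ) hC,
    coeFn_indL2 (μ := μ) (hB.union hC),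
    Lp.coeFn_sub (indL2 μ hB + indL2 μ hC) (pmul (indL2 μ hB) (indL2 μ hC)),
    Lp.coeFn_add (indL2 μ hB) (indL2 μ hC),
    coeFn_pmul (indL2 μ hB) (indL2_mem_essBall hC)] with x h1 h2 h3 h4 h5 h6
  rw [h4, Pi.sub_apply, h5, Pi.add_apply, h6, h1, h2, h3]
  by_cases h : x ∈ B <;> by_cases h' : x ∈ C <;> simp [h, h']

theorem tendsto_indL2_of_monotone {B : ℕ → Set X} (hB : ∀ n, MeasurableSet (B n))
    (hmono : Monotone B) :
    Tendsto (fun n => indL2 μ (hB n)) atTop (𝓝 (indL2 μ (MeasurableSet.iUnion hB))) := by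
  refine tendsto_indicatorConstLp_set (by simp) ?_
  have h := tendsto_measure_iInter_atTop (μ := μ) (s := fun n => (⋃ i, B i) \ B n)
    (fun n => ((MeasurableSet.iUnion hB).diff (hB n)).nullMeasurableSet)
    (fun m n hmn => Set.sdiff_subset_sdiff_right (hmono hmn)) ⟨0, measure_ne_top _ _⟩
  rw [← Set.sdiff_iUnion, Set.sdiff_self, measure_empty] at h
  refine h.congr fun n => ?_
  rw [Function.comp_apply, symmDiff_of_le (Set.subset_iUnion B n)]

/-- An idempotent of `L²` is the class of an indicator function. -/
theorem exists_eq_indL2 {f : Lp ℂ 2 μ} (hf : ∀ᵐ x ∂μ, f x * f x = f x) :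
    ∃ (C : Set X) (hC : MeasurableSet C), f = indL2 μ hC := by
  have hC : MeasurableSet {x | f x = 1} :=
    (Lp.stronglyMeasurable f).measurable (measurableSet_singleton 1)
  refine ⟨_, hC, Lp.ext ?_⟩
  filter_upwards [hf, coeFn_indL2 (μ := μ) hC] with x h1 h2
  rw [h2]
  by_cases h : f x = 1
  · simp [h]
  · have : f x = 0 := by
      by_contra h0
      exact h (mul_left_cancel₀ h0 (by rw [h1, mul_one]))
    simp [this]

/-- The sets satisfying `p` form a σ-algebra making all coordinates measurable, so it contains the
product σ-algebra. -/
theorem measurableSet_natBool_induction (p : Set (ℕ → Bool) → Prop)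
    (coord : ∀ n, p {x | x n = true}) (empty : p ∅) (compl : ∀ S, p S → p Sᶜ)
    (iUnion : ∀ S : ℕ → Set (ℕ → Bool), (∀ n, p (S n)) → p (⋃ n, S n)) :
    ∀ S, MeasurableSet S → p S := by
  let m : MeasurableSpace (ℕ → Bool) := ⟨p, empty, compl, iUnion⟩
  have hle : (MeasurableSpace.pi : MeasurableSpace (ℕ → Bool)) ≤ m :=
    iSup_le fun n => (@measurable_to_bool _ m (fun x => x n) (coord n)).comap_le
  exact fun S hS => hle S hS

/-- A multiplicative operator acts on indicator functions as a point map does. -/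
theorem exists_map_indL2_eq [StandardBorelSpace X] (V : Lp ℂ 2 μ →L[ℂ] Lp ℂ 2 μ)
    (hinv : ∀ f ∈ boundedL2 μ, V f ∈ boundedL2 μ)
    (hmul : ∀ f ∈ boundedL2 μ, ∀ g ∈ boundedL2 μ, V (pmul f g) = pmul (V f) (V g))
    (hone : V (indL2 μ MeasurableSet.univ) = indL2 μ MeasurableSet.univ) :
    ∃ (T : X → X) (hT : Measurable T),
      ∀ B (hB : MeasurableSet B), V (indL2 μ hB) = indL2 μ (hT hB) := by
  obtain ⟨φ, hφ, hφi⟩ := MeasurableSpace.measurable_injection_nat_bool_of_countablySeparated X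
  have hind : ∀ B (hB : MeasurableSet B), ∃ (C : Set X) (hC : MeasurableSet C),
      V (indL2 μ hB) = indL2 μ hC := by
    intro B hB
    obtain ⟨M, -, hM⟩ := mem_boundedL2_iff.1 (hinv _ (indL2_mem_boundedL2 hB))
    have h : pmul (V (indL2 μ hB)) (V (indL2 μ hB)) = V (indL2 μ hB) := by
      rw [← hmul _ (indL2_mem_boundedL2 hB) _ (indL2_mem_boundedL2 hB)]
      congr 1
      apply Lp.ext
      filter_upwards [coeFn_indL2 (μ := μ) hB, coeFn_pmul (indL2 μ hB) (indL2_mem_essBall hB)]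
        with x h1 h2
      rw [h2, h1]
      by_cases h : x ∈ B <;> simp [h]
    have h2 := coeFn_pmul (V (indL2 μ hB)) hM
    rw [h] at h2
    exact exists_eq_indL2 (h2.mono fun x hx => hx.symm)
  have hcoord : ∀ n, MeasurableSet {x | φ x n = true} := fun n =>
    ((measurable_pi_apply n).comp hφ) (measurableSet_singleton true)
  choose C hC hVC using fun n => hind _ (hcoord n)
  classical
  -- `Ψ` plays the role of `φ ∘ T`: its coordinates are read off from the images under `V` of the
  -- coordinate sets.
  let Ψ : X → ℕ → Bool := fun x n => decide (x ∈ C n)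
  have hΨ : Measurable Ψ := by
    refine measurable_pi_iff.2 fun n => measurable_to_bool ?_
    convert hC n using 1
    ext x
    simp [Ψ]
  have hunion : ∀ A B (hA : MeasurableSet A) (hB : MeasurableSet B),
      V (indL2 μ (hφ hA)) = indL2 μ (hΨ hA) → V (indL2 μ (hφ hB)) = indL2 μ (hΨ hB) →
      V (indL2 μ (hφ (hA.union hB))) = indL2 μ (hΨ (hA.union hB)) := by
    intro A B hA hB h1 h2
    have e1 := indL2_union (μ := μ) (hφ hA) (hφ hB)
    have e2 := indL2_union (μ := μ) (hΨ hA) (hΨ hB)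
    rw [← h1, ← h2, ← hmul _ (indL2_mem_boundedL2 _) _ (indL2_mem_boundedL2 _), ← map_add,
      ← map_sub, ← e1] at e2
    exact e2.symm
  have hm' : ∀ S : Set (ℕ → Bool), MeasurableSet S →
      ∃ hS : MeasurableSet S, V (indL2 μ (hφ hS)) = indL2 μ (hΨ hS) := by
    refine measurableSet_natBool_induction _ (fun n => ?_) ?_ ?_ ?_
    · have hn : MeasurableSet {x : ℕ → Bool | x n = true} :=
        (measurable_pi_apply n : Measurable fun x : ℕ → Bool => x n) (measurableSet_singleton true)
      refine ⟨hn, ?_⟩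
      have e : Ψ ⁻¹' {x | x n = true} = C n := by
        ext x
        simp [Ψ]
      have h := hVC n
      simp only [← e] at h
      exact h
    · refine ⟨MeasurableSet.empty, ?_⟩
      have h : V (indL2 μ MeasurableSet.empty) = indL2 μ MeasurableSet.empty := by
        rw [indL2_empty, map_zero]
      exact h
    · rintro S ⟨hS, h⟩
      have e1 := indL2_compl (μ := μ) (hφ hS)
      have e2 := indL2_compl (μ := μ) (hΨ hS)
      rw [← h, ← hone, ← map_sub, ← e1] at e2
      exact ⟨hS.compl, e2.symm⟩
    · intro S hS
      choose hm hV using hS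
      -- Partial unions make the sequence monotone, so that indicators converge in L² and continuity
      -- of `V` applies.
      have hacc : ∀ n, MeasurableSet (Set.accumulate S n) := fun n =>
        MeasurableSet.biUnion (Set.to_countable _) fun i _ => hm i
      have hVacc : ∀ n, V (indL2 μ (hφ (hacc n))) = indL2 μ (hΨ (hacc n)) := by
        intro n
        induction n with
        | zero => simpa only [Set.accumulate_zero_nat] using hV 0
        | succ n ih =>
          simpa only [Set.accumulate_succ] using hunion _ _ (hacc n) (hm (n + 1)) ih (hV (n + 1))
      rw [← Set.iUnion_accumulate]
      refine ⟨MeasurableSet.iUnion hacc, ?_⟩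
      have h1 := tendsto_indL2_of_monotone (μ := μ) (fun n => hφ (hacc n))
        (fun i j hij => Set.preimage_mono (Set.monotone_accumulate hij))
      have h2 := tendsto_indL2_of_monotone (μ := μ) (fun n => hΨ (hacc n))
        (fun i j hij => Set.preimage_mono (Set.monotone_accumulate hij))
      have h4 := tendsto_nhds_unique ((V.continuous.tendsto _).comp h1)
        (h2.congr fun n => (hVacc n).symm)
      simpa only [Set.preimage_iUnion] using h4
  have hm : ∀ S (hS : MeasurableSet S), V (indL2 μ (hφ hS)) = indL2 μ (hΨ hS) :=
    fun S hS => (hm' S hS).2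
  have hemb : MeasurableEmbedding φ := hφ.measurableEmbedding hφi
  have hX : Nonempty X := nonempty_of_isProbabilityMeasure μ
  -- `ψ` is a measurable left inverse of `φ`.
  obtain ⟨ψ, hψ, hψφ⟩ := hemb.exists_measurable_extend measurable_id fun _ => hX
  have hrange : ∀ᵐ x ∂μ, Ψ x ∈ Set.range φ := by
    -- Taking `S = range φ`, the hypothesis `V 1 = 1` forces `Ψ` into the range a.e.
    have h := hm _ hemb.measurableSet_range
    have e : φ ⁻¹' Set.range φ = Set.univ := Set.preimage_range φ
    simp only [e, hone] at h
    filter_upwards [coeFn_indL2 (μ := μ) MeasurableSet.univ,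
      coeFn_indL2 (μ := μ) (hΨ hemb.measurableSet_range)] with x h1 h2
    rw [← h, h1] at h2
    by_contra hx
    have hx' : x ∉ Ψ ⁻¹' Set.range φ := hx
    simp [hx'] at h2
  refine ⟨ψ ∘ Ψ, hψ.comp hΨ, fun B hB => ?_⟩
  have h := hm _ (hemb.measurableSet_image.2 hB)
  simp only [Set.preimage_image_eq _ hφi] at h
  rw [h]
  refine (indicatorConstLp_inj _ _ _ _ one_ne_zero).2 ?_
  filter_upwards [hrange] with x ⟨y, hy⟩
  have e : ψ (Ψ x) = y := by rw [← hy]; exact congr_fun hψφ y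
  refine propext ⟨?_, fun hx => ?_⟩
  · rintro ⟨z, hz, hzx⟩
    have : z = y := hφi (hzx.trans hy.symm)
    change ψ (Ψ x) ∈ B
    rwa [e, ← this]
  · change ψ (Ψ x) ∈ B at hx
    exact ⟨y, e ▸ hx, hy⟩

/-- An operator that acts on indicator functions as a point map does is the composition operator
with that map. -/
theorem isCompositionBy_of_map_indL2 {V : Lp ℂ 2 μ →L[ℂ] Lp ℂ 2 μ} {T : X → X}
    (hT : Measurable T) (hV : ∀ B (hB : MeasurableSet B), V (indL2 μ hB) = indL2 μ (hT hB)) :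
    IsCompositionBy V T := by
  have hq : Measure.QuasiMeasurePreserving T μ μ := by
    refine ⟨hT, Measure.AbsolutelyContinuous.mk fun B hB h0 => ?_⟩
    rw [Measure.map_apply hT hB]
    have h1 : indL2 μ hB = 0 := by
      rw [← indL2_empty]
      exact (indicatorConstLp_inj _ _ _ _ one_ne_zero).2 (ae_eq_empty.2 h0)
    have h2 : indL2 μ (hT hB) = indL2 μ MeasurableSet.empty := by
      rw [← hV B hB, h1, indL2_empty, map_zero]
    exact ae_eq_empty.1 ((indicatorConstLp_inj _ _ _ _ one_ne_zero).1 h2)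
  refine isCompositionBy_of_ae hq ?_
  refine Lp.induction (by simp) _ ?_ ?_ ?_
  · intro c B hB hμB
    rw [Lp.simpleFunc.coe_indicatorConst]
    have e : indicatorConstLp 2 hB hμB.ne c = c • indL2 μ hB := by
      apply Lp.ext
      filter_upwards [indicatorConstLp_coeFn (p := 2) (hs := hB) (hμs := hμB.ne) (c := c),
        coeFn_indL2 (μ := μ) hB, Lp.coeFn_smul c (indL2 μ hB)] with x h1 h2 h3
      rw [h3, h1, Pi.smul_apply, h2]
      by_cases h : x ∈ B <;> simp [h]
    rw [e, map_smul, hV]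
    filter_upwards [Lp.coeFn_smul c (indL2 μ (hT hB)), coeFn_indL2 (μ := μ) (hT hB),
      hq.ae (Lp.coeFn_smul c (indL2 μ hB)), hq.ae (coeFn_indL2 (μ := μ) hB)] with x h1 h2 h3 h4
    rw [h1, Function.comp_apply, h3, Pi.smul_apply, Pi.smul_apply, h2, h4]
    rfl
  · intro f g hf hg _ h1 h2
    rw [map_add]
    filter_upwards [Lp.coeFn_add (V (hf.toLp f)) (V (hg.toLp g)), h1, h2,
      hq.ae (Lp.coeFn_add (hf.toLp f) (hg.toLp g))] with x e1 e2 e3 e4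
    rw [e1, Pi.add_apply, e2, e3, Function.comp_apply (f := ⇑(hf.toLp f + hg.toLp g)), e4]
    rfl
  · refine IsSeqClosed.isClosed fun u f hu huf => ?_
    -- Nested subsequences give a.e. convergence of `V (u i)` and of `u i`; the latter is pulled
    -- back along `T` by `hq`.
    obtain ⟨ns, hns, h1⟩ := exists_subseq_tendsto_ae ((V.continuous.tendsto f).comp huf)
    obtain ⟨ks, hks, h2⟩ := exists_subseq_tendsto_ae (huf.comp hns.tendsto_atTop)
    filter_upwards [h1, hq.ae h2, ae_all_iff.2 hu] with x e1 e2 e3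
    refine tendsto_nhds_unique (e1.comp hks.tendsto_atTop) (e2.congr fun i => ?_)
    exact (e3 _).symm

theorem exists_isCompositionBy [StandardBorelSpace X] (V : Lp ℂ 2 μ →L[ℂ] Lp ℂ 2 μ)
    (hinv : ∀ f ∈ boundedL2 μ, V f ∈ boundedL2 μ)
    (hmul : ∀ f ∈ boundedL2 μ, ∀ g ∈ boundedL2 μ, V (pmul f g) = pmul (V f) (V g))
    (hone : V (indL2 μ MeasurableSet.univ) = indL2 μ MeasurableSet.univ) :
    ∃ T : X → X, Measurable T ∧ IsCompositionBy V T := by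
  obtain ⟨T, hT, h⟩ := exists_map_indL2_eq V hinv hmul hone
  exact ⟨T, hT, isCompositionBy_of_map_indL2 hT h⟩

namespace IsCompositionBy

variable {V : Lp ℂ 2 μ →L[ℂ] Lp ℂ 2 μ} {T : X → X}

/-- This is where `IsCompositionBy` ranging over functions matters: for null `B`, the indicator of
`B` has class 0, so its composite with `T` vanishes a.e. -/
theorem quasiMeasurePreserving (h : IsCompositionBy V T) (hT : Measurable T) :
    Measure.QuasiMeasurePreserving T μ μ := by
  refine ⟨hT, Measure.AbsolutelyContinuous.mk fun B hB h0 => ?_⟩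
  rw [Measure.map_apply hT hB]
  have hB0 : indL2 μ hB = 0 := by
    rw [← indL2_empty]
    exact (indicatorConstLp_inj _ _ _ _ one_ne_zero).2 (ae_eq_empty.2 h0)
  have h1 := h (B.indicator fun _ => 1) (memLp_indicator_const 2 hB 1 (Or.inr (measure_ne_top μ B)))
  change V (indL2 μ hB) =ᵐ[μ] _ at h1
  rw [hB0, map_zero] at h1
  rw [← ae_eq_empty]
  filter_upwards [h1, Lp.coeFn_zero ℂ 2 μ] with x h2 h3
  rw [h3] at h2
  refine propext ⟨fun hx => ?_, fun hx => hx.elim⟩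
  have hx' : T x ∈ B := hx
  simp [hx'] at h2

theorem mem_essBall (h : IsCompositionBy V T) (hT : Measurable T) {f : Lp ℂ 2 μ} {M : ℝ}
    (hf : f ∈ essBall μ M) : V f ∈ essBall μ M := by
  filter_upwards [h.coeFn f, (h.quasiMeasurePreserving hT).ae hf] with x h1 h2
  rwa [h1]

theorem mem_boundedL2 (h : IsCompositionBy V T) (hT : Measurable T) {f : Lp ℂ 2 μ}
    (hf : f ∈ boundedL2 μ) : V f ∈ boundedL2 μ := by
  obtain ⟨M, hM, hfM⟩ := mem_boundedL2_iff.1 hf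
  exact mem_boundedL2_iff.2 ⟨M, hM, h.mem_essBall hT hfM⟩

theorem map_pmul (h : IsCompositionBy V T) (hT : Measurable T) (f : Lp ℂ 2 μ) {g : Lp ℂ 2 μ}
    (hg : g ∈ boundedL2 μ) : V (pmul f g) = pmul (V f) (V g) := by
  obtain ⟨M, hM, hgM⟩ := mem_boundedL2_iff.1 hg
  apply Lp.ext
  filter_upwards [h.coeFn f, h.coeFn g, h.coeFn (pmul f g), coeFn_pmul (V f) (h.mem_essBall hT hgM),
    (h.quasiMeasurePreserving hT).ae (coeFn_pmul f hgM)] with x h1 h2 h3 h4 h5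
  rw [h3, h4, h5, h1, h2]

end IsCompositionBy

end PointRealization

/-! ### The equivalence -/

theorem corollary2p9 {X : Type*} [MeasurableSpace X] [StandardBorelSpace X]
    (μ : Measure X) [IsProbabilityMeasure μ]
    (U : ℝ → Lp ℂ 2 μ →L[ℂ] Lp ℂ 2 μ) (hU : IsC0Group U) :
    (∀ t : ℝ, ∃ T : X → X, Measurable T ∧ IsCompositionBy (U t) T) ↔
      ((∀ t : ℝ, ∀ f ∈ boundedL2 μ, U t f ∈ boundedL2 μ) ∧
        IsFunctionAlgebra ((generator U).domain ⊓ boundedL2 μ) ∧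
        IsDerivationOn (generator U) ((generator U).domain ⊓ boundedL2 μ)) := by
  constructor
  · intro h
    choose T hT hUT using h
    have hinv : ∀ t : ℝ, ∀ f ∈ boundedL2 μ, U t f ∈ boundedL2 μ := fun t f hf =>
      (hUT t).mem_boundedL2 (hT t) hf
    have hder : ∀ f ∈ boundedL2 μ, ∀ g ∈ boundedL2 μ, ∀ f' g', HasGeneratorValue U f f' →
        HasGeneratorValue U g g' →
        HasGeneratorValue U (pmul f g) (pmul f' g + pmul f g') := by
      intro f hf g hg f' g' hf' hg'
      rw [hasGeneratorValue_iff_hasDerivAt hU]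
      have h := hasDerivAt_pmul_orbit hU hinv hf hg hf' hg' 0
      simp only [hU.apply_zero] at h
      refine h.congr_of_eventuallyEq (Eventually.of_forall fun t => ?_)
      exact (hUT t).map_pmul (hT t) f hg
    refine ⟨hinv, ?_, ?_⟩
    · rintro f ⟨⟨f', hf'⟩, hf⟩ g ⟨⟨g', hg'⟩, hg⟩
      exact ⟨pmul f g, ⟨⟨_, hder f hf g hg f' g' hf' hg'⟩, pmul_mem_boundedL2 hf hg⟩,
        coe_pmul_of_mem f hg⟩
    · rintro f g h ⟨-, hf⟩ ⟨-, hg⟩ - hfg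
      have e : (h : Lp ℂ 2 μ) = pmul f g := Subtype.ext (hfg.trans (coe_pmul_of_mem _ hg).symm)
      have h1 := generator_hasGeneratorValue h
      rw [e] at h1
      rw [h1.unique (hder f hf g hg _ _ (generator_hasGeneratorValue f)
        (generator_hasGeneratorValue g)), AddSubgroup.coe_add, coe_pmul_of_mem _ hg, coe_pmul_of_mem' _ hf]
  · rintro ⟨hinv, halg, hD⟩ t
    have hder : ∀ f ∈ boundedL2 μ, ∀ g ∈ boundedL2 μ, ∀ f' g', HasGeneratorValue U f f' →
        HasGeneratorValue U g g' →
        HasGeneratorValue U (pmul f g) (pmul f' g + pmul f g') := by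
      intro f hf g hg f' g' hf' hg'
      obtain ⟨h, ⟨hdom, hb⟩, hfg⟩ := halg f ⟨⟨f', hf'⟩, hf⟩ g ⟨⟨g', hg'⟩, hg⟩
      obtain rfl : h = pmul f g := Subtype.ext (hfg.trans (coe_pmul_of_mem _ hg).symm)
      have h1 := hD ⟨f, f', hf'⟩ ⟨g, g', hg'⟩ ⟨_, hdom⟩ ⟨⟨f', hf'⟩, hf⟩ ⟨⟨g', hg'⟩, hg⟩
        ⟨hdom, hb⟩ hfg
      have h2 := generator_hasGeneratorValue (U := U) ⟨_, hdom⟩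
      have ef := (generator_hasGeneratorValue (U := U) ⟨f, f', hf'⟩).unique hf'
      have eg := (generator_hasGeneratorValue (U := U) ⟨g, g', hg'⟩).unique hg'
      rw [ef, eg, ← coe_pmul_of_mem _ hg, ← coe_pmul_of_mem' _ hf, ← AddSubgroup.coe_add] at h1
      rwa [Subtype.ext h1] at h2
    have hmul : ∀ f ∈ boundedL2 μ, ∀ g ∈ boundedL2 μ, U t (pmul f g) = pmul (U t f) (U t g) :=
      fun f hf g hg => map_pmul_of_derivation hU hinv hder hf hg t
    refine exists_isCompositionBy (U t) (hinv t) hmul ?_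
    have h1 : indL2 μ MeasurableSet.univ ∈ boundedL2 μ := indL2_mem_boundedL2 _
    -- Multiplicativity at `U (-t) 1` and `1` reads `1 = 1 · U t 1`, so `U t` fixes the unit.
    have h := hmul _ (hinv (-t) _ h1) _ h1
    rw [pmul_indL2_univ, hU.apply_apply_neg, pmul_comm, pmul_indL2_univ] at h
    exact h.symm
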